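/- Let $\mathcal M=(S,A,T,p_0,r,\gamma,O,\Omega)$ be a finite POMDP with transition probabilities $T(s,a,s')$, observation probabilities $\Omega(s,o)$, reward $r:S\to\mathbb R$, discount factor $\gamma\in(0,1)$ and $A\ne\emptyset$. For a belief $b\in\mathrm{Dist}(S)$, taking $a\in A$ and observing $o$ updates $b$ to the belief $b'$ with $b'(s')\propto\Omega(s',o)\sum_s T(s,a,s')b(s)$; let $T_{\mathcal D}(b,a,b')$ be the resulting transition probabilities between beliefs. Let $\varphi$ be an iLTL formula, i.e. built from atomic propositions $f:\mathbb R^{S}\to\mathbb R$ by $\neg,\wedge,\mathsf X,\mathsf U_T$ ($T\in\mathbb N\cup\{\infty\}$), and let $L(b)$ be the set of its atomic propositions with $f(b)>0$. Let $\mathcal A=(Q,\Sigma,\delta,q_0,B)$ be a finite limit-deterministic Büchi automaton whose alphabet $\Sigma$ consists of the sets of atomic propositions of $\varphi$, with accepting set $B$ and finitely many (partially defined) silent moves $\varepsilon$. In the product belief MDP on $\mathrm{Dist}(S)\times Q$, an action $a\in A$ leads from $(b,q)$ to $(b',\delta(q,L(b)))$ with probability $T_{\mathcal D}(b,a,b')$,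 and a silent action $\varepsilon$ with $\delta(q,\varepsilon)$ defined leads to $(b,\delta(q,\varepsilon))$ with probability $1$. For every $q\in Q$ and every action $a$ (in $A$ or silent) let $\Theta^0_{q,a}\subseteq\mathbb R^{S}$ be a finite set, nonempty if $a\in A$. Finite sets $\Theta^k_{q,a}$ of vectors represent $$Q^k_r((b,q),a)=\max_{\theta\in\Theta^k_{q,a}}\sum_{s}\theta(s)b(s),\qquad V^k_r((b,q))=\max_{\theta\in\Theta^k_{q}}\sum_{s}\theta(s)b(s),\qquad \Theta^k_q=\bigcup_a\Theta^k_{q,a}.$$ In each round $k$, for all $q\in Q$ and all $a$, finitely many (possibly no) vectors of the form $$r+\frac{\gamma}{n}\sum_{i=1}^n \theta_i,\qquad \theta_i\in\operatorname*{arg\,max}_{\theta\in\Theta^k_{q'}}\sum_{s}\theta(s)b_i'(s),$$ are added to $\Theta^k_{q,a}$, where $n\ge1$, $b$ is a belief, and $(b'_1,q'),\dots,(b'_n,q')$ are sampled successors, i.e. states of the product belief MDP reached with positive probability from $(b,q)$ under $a$; $b$, $n$, the samples and the choice among maximizers are arbitrary and may vary with $k$, $q$, $a$ and the vector. Then the set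 is pruned: some vectors are removed so that $\max_\theta\sum_s\theta(s)b(s)$ does not change at any belief $b$. The result is $\Theta^{k+1}_{q,a}$. Then $V^k_r$ converges as $k\to\infty$, uniformly on $\mathrm{Dist}(S)\times Q$, and so does $Q^k_r$, uniformly over all $(b,q)$ and all $a$ such that $\Theta^k_{q,a}$ is nonempty for some $k$ (in particular all $a\in A$). The same holds for the functions $Q^k_p,V^k_p$ of the Büchi constraint, for which the added vectors are $\frac1n\sum_{i=1}^n\theta_i$ (no reward, no discount) and the value $V_p((b,q))=1$ is prescribed for $q\in B$, i.e. $\Theta^k_q$ is replaced by $\{(1,\dots,1)\}$ for $q\in B$. -/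

import Mathlib

noncomputable section

/-- Probability distributions on the finite set `S`: the belief space. -/
abbrev Belief (S : Type*) [Fintype S] : Type _ := ↥(stdSimplex ℝ S)

/-- A partially observable Markov decision process with states `S`, actions `A`, observations `O`:
transition probabilities `T`, initial distribution `p0`, immediate reward `r`, discount factor `γ`
and observation probabilities `Om`. -/
structure POMDP (S A O : Type*) [Fintype S] [Fintype O] where
  T : S → A → S → ℝ
  T_nonneg : ∀ s a s', 0 ≤ T s a s'
  T_sum : ∀ s a, ∑ s', T s a s' = 1
  p0 : Belief S
  r : S → ℝ
  γ : ℝ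
  γ_mem : γ ∈ Set.Ioo (0 : ℝ) 1
  Om : S → O → ℝ
  Om_nonneg : ∀ s o, 0 ≤ Om s o
  Om_sum : ∀ s, ∑ o, Om s o = 1

namespace POMDP

variable {S A O : Type*} [Fintype S] [Fintype O]

/-- The Bayes update of the belief `b` after taking action `a` and observing `o`. It is a
probability distribution when `o` has positive probability; otherwise the division by zero yields
the zero vector, which is not a belief. -/
def beliefUpdate (M : POMDP S A O) (b : Belief S) (a : A) (o : O) : S → ℝ := fun s' =>
  (M.Om s' o * ∑ s, M.T s a s' * b.1 s) / ∑ t, M.Om t o * ∑ s, M.T s a t * b.1 s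

open Classical in
/-- Indicator that the Bayes update of `b` under `a` and `o` returns `b'`. -/
def eta (M : POMDP S A O) (b : Belief S) (a : A) (o : O) (b' : Belief S) : ℝ :=
  if M.beliefUpdate b a o = b'.1 then 1 else 0

/-- Transition probabilities of the belief MDP. -/
def beliefTrans (M : POMDP S A O) (b : Belief S) (a : A) (b' : Belief S) : ℝ :=
  ∑ o, ∑ s', ∑ s, M.eta b a o b' * M.Om s' o * M.T s a s' * b.1 s

end POMDP

/-- iLTL formulas over distributions on `S`; atomic propositions are functions `ℝ^S → ℝ`, and the
bound of "until" may be infinite. -/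
inductive ILTL (S : Type*) where
  | atom (f : (S → ℝ) → ℝ) : ILTL S
  | not (φ : ILTL S) : ILTL S
  | and (φ ψ : ILTL S) : ILTL S
  | next (φ : ILTL S) : ILTL S
  | untl (T : ℕ∞) (φ ψ : ILTL S) : ILTL S

namespace ILTL

variable {S : Type*}

/-- The atomic propositions that occur in a formula. -/
def atoms : ILTL S → Set ((S → ℝ) → ℝ)
  | atom f => {f}
  | not φ => φ.atoms
  | and φ ψ => φ.atoms ∪ ψ.atoms
  | next φ => φ.atoms
  | untl _ φ ψ => φ.atoms ∪ ψ.atoms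

/-- The label `L(b)`: the atomic propositions `f` in `φ` with `f(b) > 0`. -/
def label [Fintype S] (φ : ILTL S) (b : Belief S) : Set φ.atoms := {f | 0 < f.1 b.1}

end ILTL

/-- A limit-deterministic Büchi automaton with states `Q`, alphabet `Sig` and silent symbols `E`
(a singleton for one symbol `ε`; several symbols `ε₁, ε₂, …` distinguish several silent moves).
The transition function is total on `Sig` and partial on `E`. -/
structure LDBA (Q Sig E : Type*) where
  δ : Q → Sig → Q
  eps : Q → E → Option Q
  q0 : Q
  B : Set Q
  /-- The accepting component: closed under transitions, contains `B`, and has no silent moves. -/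
  bipartition : ∃ QA : Set Q, (∀ q ∈ QA, ∀ σ, δ q σ ∈ QA) ∧ B ⊆ QA ∧ ∀ q ∈ QA, ∀ e, eps q e = none

section Product

variable {S A O Q E : Type*} [Fintype S] [Fintype O]

open Classical in
/-- Transition probabilities of the product belief MDP; its actions are those of the POMDP and the
silent ones. -/
def prodTrans (M : POMDP S A O) (φ : ILTL S) (D : LDBA Q (Set φ.atoms) E) :
    Belief S × Q → A ⊕ E → Belief S × Q → ℝ
  | (b, q), Sum.inl a, (b', q') => if q' = D.δ q (φ.label b) then M.beliefTrans b a b' else 0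
  | (b, q), Sum.inr e, (b', q') => if D.eps q e = some q' ∧ b = b' then 1 else 0

/-- A family of sets `Θ_{q,a}` of α-vectors. -/
abbrev AlphaSets (S A Q E : Type*) : Type _ := Q → A ⊕ E → Set (S → ℝ)

/-- `max_{θ ∈ Θ} ∑ s, θ(s) b(s)` (a maximum when `Θ` is finite and nonempty). -/
def maxValue (Θ : Set (S → ℝ)) (b : Belief S) : ℝ :=
  sSup ((fun θ : S → ℝ => ∑ s, θ s * b.1 s) '' Θ)

open Classical in
/-- The vectors `Θ_q` representing the value function at `q`: the union of all `Θ_{q,a}`, except on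
the set `F` of automaton states where the value is prescribed to be `1`. -/
def stateVectors (F : Set Q) (Θ : AlphaSets S A Q E) (q : Q) : Set (S → ℝ) :=
  if q ∈ F then {fun _ => 1} else ⋃ a, Θ q a

/-- The Q-function represented by `Θ`. -/
def qValue (Θ : AlphaSets S A Q E) (x : Belief S × Q) (a : A ⊕ E) : ℝ :=
  maxValue (Θ x.2 a) x.1

/-- The value function represented by `Θ` (with value `1` prescribed on `F`). -/
def vValue (F : Set Q) (Θ : AlphaSets S A Q E) (x : Belief S × Q) : ℝ :=
  maxValue (stateVectors F Θ x.2) x.1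

/-- `ϑ` is a vector that the sample-based rule adds to `Θ_{q,a}`: for some belief `b` and some
`n ≥ 1` sampled transitions from `(b, q)` under `a` to `(b'_i, q')`, it is
`ρ + (g / n) ∑ i, argmax_{θ ∈ Θ_{q'}} ∑ s, θ(s) b'_i(s)`, with ties broken arbitrarily. -/
def IsSampleBackup (M : POMDP S A O) (φ : ILTL S) (D : LDBA Q (Set φ.atoms) E)
    (ρ : S → ℝ) (g : ℝ) (F : Set Q) (Θ : AlphaSets S A Q E) (q : Q) (a : A ⊕ E)
    (ϑ : S → ℝ) : Prop :=
  ∃ (b : Belief S) (q' : Q) (n : ℕ) (b' : Fin n → Belief S) (θ : Fin n → S → ℝ),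
    0 < n ∧
    (∀ i, 0 < prodTrans M φ D (b, q) a (b' i, q')) ∧
    (∀ i, θ i ∈ stateVectors F Θ q' ∧
      ∀ θ' ∈ stateVectors F Θ q', ∑ s, θ' s * (b' i).1 s ≤ ∑ s, θ i s * (b' i).1 s) ∧
    ϑ = ρ + (g / n) • ∑ i, θ i

/-- `Θ'` results from `Θ` by removing vectors that are not needed for the maximum at any belief. -/
def IsPruning (Θ Θ' : Set (S → ℝ)) : Prop :=
  Θ' ⊆ Θ ∧ ∀ b : Belief S, ∀ θ ∈ Θ, ∃ θ' ∈ Θ', ∑ s, θ s * b.1 s ≤ ∑ s, θ' s * b.1 s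

/-- One round of the iteration: to each `Θ_{q,a}` finitely many vectors given by the sample-based
rule are added (none, if `(q, a)` is not visited in this round), and the result is pruned. -/
def IsUpdate (M : POMDP S A O) (φ : ILTL S) (D : LDBA Q (Set φ.atoms) E)
    (ρ : S → ℝ) (g : ℝ) (F : Set Q) (Θ Θ' : AlphaSets S A Q E) : Prop :=
  ∀ q a, ∃ N : Set (S → ℝ), N.Finite ∧ (∀ ϑ ∈ N, IsSampleBackup M φ D ρ g F Θ q a ϑ) ∧
    IsPruning (Θ q a ∪ N) (Θ' q a)

/-- The iteration for the reward: reward vector `r`, discount `γ`, no prescribed values. -/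
def IsRewardUpdate (M : POMDP S A O) (φ : ILTL S) (D : LDBA Q (Set φ.atoms) E)
    (Θ Θ' : AlphaSets S A Q E) : Prop :=
  IsUpdate M φ D M.r M.γ ∅ Θ Θ'

/-- The iteration for the Büchi constraint: no reward, no discount, value `1` on accepting states. -/
def IsBuchiUpdate (M : POMDP S A O) (φ : ILTL S) (D : LDBA Q (Set φ.atoms) E)
    (Θ Θ' : AlphaSets S A Q E) : Prop :=
  IsUpdate M φ D 0 1 D.B Θ Θ'

/-- Admissible initial sets: all finite, and nonempty for the actions of the POMDP. The sets of
silent actions may be empty (for instance because the silent move is not available). -/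
def IsInitial (Θ : AlphaSets S A Q E) : Prop :=
  (∀ q a, (Θ q a).Finite) ∧ ∀ q (a : A), (Θ q (Sum.inl a)).Nonempty

/-- Along the iterates `Θ k`, the represented Q-function (at all `(b, q)` and `a` for which
`Θ_{q,a}` is nonempty at some stage) and value function converge uniformly. -/
def QVConverge (F : Set Q) (Θ : ℕ → AlphaSets S A Q E) : Prop :=
  (∃ Qlim : (Belief S × Q) × (A ⊕ E) → ℝ,
    TendstoUniformlyOn (fun k (y : (Belief S × Q) × (A ⊕ E)) => qValue (Θ k) y.1 y.2) Qlim
      Filter.atTop {y | ∃ k, (Θ k y.1.2 y.2).Nonempty}) ∧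
  (∃ Vlim : Belief S × Q → ℝ,
    TendstoUniformly (fun k x => vValue F (Θ k) x) Vlim Filter.atTop)

end Product

end

/-! The convergence is a monotone one, upgraded by Dini's theorem. A round only adds vectors, and
pruning leaves the upper envelope unchanged, so each represented function is nondecreasing in `k`
(`IsUpdate.exists_ge`, `IsUpdate.exists_ge_stateVectors`). A bound `C` on all entries survives every
round (`IsUpdate.bounded`). Hence the envelopes are bounded above, so they converge pointwise, and
they share the Lipschitz constant `card S * C`, so the limit is continuous. As the simplex is
compact, the convergence is uniform (`exists_tendstoUniformly_maxValue`). Finiteness of `Q`, `A` and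
`E` makes it uniform over states and actions. -/

theorem abs_pairing_sub_le {S : Type*} [Fintype S] {C : ℝ} {θ : S → ℝ} (hθ : ∀ s, |θ s| ≤ C)
    (b c : S → ℝ) :
    |∑ s, θ s * b s - ∑ s, θ s * c s| ≤ Fintype.card S * C * dist b c := by
  have h : ∀ s ∈ Finset.univ, |θ s * (b s - c s)| ≤ C * dist b c := fun s _ => by
    rw [abs_mul, ← Real.dist_eq]
    exact mul_le_mul (hθ s) (dist_le_pi_dist b c s) dist_nonneg ((abs_nonneg _).trans (hθ s))
  calc |∑ s, θ s * b s - ∑ s, θ s * c s| = |∑ s, θ s * (b s - c s)| := by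
        rw [← Finset.sum_sub_distrib]; simp only [mul_sub]
    _ ≤ ∑ s, |θ s * (b s - c s)| := Finset.abs_sum_le_sum_abs _ _
    _ ≤ ∑ _s : S, C * dist b c := Finset.sum_le_sum h
    _ = Fintype.card S * C * dist b c := by simp [mul_assoc]

theorem pairing_le_of_bounded {S : Type*} [Fintype S] {C : ℝ} {θ : S → ℝ}
    (hθ : ∀ s, |θ s| ≤ C) (b : Belief S) : ∑ s, θ s * b.1 s ≤ C :=
  calc ∑ s, θ s * b.1 s ≤ ∑ s, C * b.1 s := Finset.sum_le_sum fun s _ =>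
        mul_le_mul_of_nonneg_right ((le_abs_self _).trans (hθ s)) (b.2.1 s)
    _ = C := by rw [← Finset.mul_sum, b.2.2, mul_one]

theorem pairing_le_maxValue {S : Type*} [Fintype S] {C : ℝ} {W : Set (S → ℝ)}
    (hW : ∀ θ ∈ W, ∀ s, |θ s| ≤ C) (b : Belief S) {θ : S → ℝ} (hθ : θ ∈ W) :
    ∑ s, θ s * b.1 s ≤ maxValue W b := by
  refine le_csSup ⟨C, ?_⟩ ⟨θ, hθ, rfl⟩
  rintro _ ⟨θ', hθ', rfl⟩
  exact pairing_le_of_bounded (hW θ' hθ') b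

theorem maxValue_le_of_forall {S : Type*} [Fintype S] {W : Set (S → ℝ)} (hne : W.Nonempty)
    {b : Belief S} {x : ℝ} (h : ∀ θ ∈ W, ∑ s, θ s * b.1 s ≤ x) : maxValue W b ≤ x := by
  refine csSup_le (hne.image _) ?_
  rintro _ ⟨θ, hθ, rfl⟩
  exact h θ hθ

/-- A supremum of linear functions with a common Lipschitz constant keeps that constant, however
many vectors `W` contains. -/
theorem lipschitzWith_maxValue {S : Type*} [Fintype S] {C : NNReal} {W : Set (S → ℝ)}
    (hne : W.Nonempty) (hW : ∀ θ ∈ W, ∀ s, |θ s| ≤ C) :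
    LipschitzWith (Fintype.card S * C) (maxValue W) := by
  refine LipschitzWith.of_le_add_mul _ fun b c => maxValue_le_of_forall hne fun θ hθ => ?_
  have h₁ := (abs_le.1 (abs_pairing_sub_le (hW θ hθ) b.1 c.1)).2
  have h₂ := pairing_le_maxValue hW c hθ
  push_cast
  rw [Subtype.dist_eq]
  linarith

/-- Uniform convergence of the upper envelopes of bounded sets of vectors, each of which dominates
the previous one. -/
theorem exists_tendstoUniformly_maxValue {S : Type*} [Fintype S] {C : NNReal}
    {W : ℕ → Set (S → ℝ)} (hW : ∀ k, ∀ θ ∈ W k, ∀ s, |θ s| ≤ C)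
    (hdom : ∀ k, ∀ b : Belief S, ∀ θ ∈ W k, ∃ θ' ∈ W (k + 1),
      ∑ s, θ s * b.1 s ≤ ∑ s, θ' s * b.1 s) (hne : (W 0).Nonempty) :
    ∃ l : Belief S → ℝ, TendstoUniformly (fun k => maxValue (W k)) l Filter.atTop := by
  -- Domination is stated belief by belief, so some belief is needed to pass nonemptiness from `W k`
  -- to `W (k + 1)`. There is none when `S` is empty.
  rcases isEmpty_or_nonempty (Belief S) with hS | ⟨⟨b₀⟩⟩
  · exact ⟨fun _ => 0, fun u _ => Filter.Eventually.of_forall fun _ x => isEmptyElim x⟩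
  have hne' : ∀ k, (W k).Nonempty := fun k => by
    induction k with
    | zero => exact hne
    | succ k ih =>
      obtain ⟨θ, hθ⟩ := ih
      obtain ⟨θ', hθ', -⟩ := hdom k b₀ θ hθ
      exact ⟨θ', hθ'⟩
  have hmono : ∀ b, Monotone fun k => maxValue (W k) b := fun b =>
    monotone_nat_of_le_succ fun k => maxValue_le_of_forall (hne' k) fun θ hθ => by
      obtain ⟨θ', hθ', h⟩ := hdom k b θ hθ
      exact h.trans (pairing_le_maxValue (hW (k + 1)) b hθ')
  have hbdd : ∀ b, BddAbove (Set.range fun k => maxValue (W k) b) := fun b => by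
    refine ⟨C, ?_⟩
    rintro _ ⟨k, rfl⟩
    exact maxValue_le_of_forall (hne' k) fun θ hθ => pairing_le_of_bounded (hW k θ hθ) b
  have htend := fun b => tendsto_atTop_ciSup (hmono b) (hbdd b)
  have hlip := fun k => lipschitzWith_maxValue (hne' k) (hW k)
  -- The common Lipschitz constant passes to the pointwise limit, which gives the continuity that
  -- Dini's theorem requires.
  have hliplim : LipschitzWith (Fintype.card S * C) fun b => ⨆ k, maxValue (W k) b := by
    refine LipschitzWith.of_dist_le_mul fun b c => ?_
    exact le_of_tendsto ((htend b).dist (htend c))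
      (Filter.Eventually.of_forall fun k => (hlip k).dist_le_mul b c)
  exact ⟨_, Monotone.tendstoUniformly_of_forall_tendsto (fun k => (hlip k).continuous)
    (fun _ _ h b => hmono b h) hliplim.continuous htend⟩

/-- The set of a silent action may be empty at first. Its `maxValue` is then the default `sSup ∅ =
0`, from which the first vector may lead downwards, so monotonicity is used only from a nonempty
stage `m` on. -/
theorem exists_tendstoUniformly_maxValue_of_nonempty {S : Type*} [Fintype S] {C : NNReal}
    {W : ℕ → Set (S → ℝ)} (hW : ∀ k, ∀ θ ∈ W k, ∀ s, |θ s| ≤ C)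
    (hdom : ∀ k, ∀ b : Belief S, ∀ θ ∈ W k, ∃ θ' ∈ W (k + 1),
      ∑ s, θ s * b.1 s ≤ ∑ s, θ' s * b.1 s) (hne : ∃ k, (W k).Nonempty) :
    ∃ l : Belief S → ℝ, TendstoUniformly (fun k => maxValue (W k)) l Filter.atTop := by
  obtain ⟨m, hm⟩ := hne
  obtain ⟨l, hl⟩ := exists_tendstoUniformly_maxValue (W := fun k => W (k + m))
    (fun k => hW (k + m))
    (fun k => by simpa only [Nat.add_right_comm k 1 m] using hdom (k + m)) (by simpa using hm)
  refine ⟨l, fun u hu => ?_⟩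
  obtain ⟨N, hN⟩ := Filter.eventually_atTop.1 (hl u hu)
  refine Filter.eventually_atTop.2 ⟨N + m, fun k hk => ?_⟩
  obtain ⟨j, rfl⟩ := Nat.exists_eq_add_of_le hk
  simpa only [Nat.add_right_comm N m j] using hN (N + j) (Nat.le_add_right N j)

theorem stateVectors_bounded {S A Q E : Type*} {F : Set Q} {C : ℝ}
    {Θ : AlphaSets S A Q E} (hC : 1 ≤ C) (hΘ : ∀ q a, ∀ θ ∈ Θ q a, ∀ s, |θ s| ≤ C) :
    ∀ q, ∀ θ ∈ stateVectors F Θ q, ∀ s, |θ s| ≤ C := by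
  intro q θ hθ s
  unfold stateVectors at hθ
  split_ifs at hθ with hq
  · rw [Set.mem_singleton_iff.1 hθ]
    simpa using hC
  · obtain ⟨a, ha⟩ := Set.mem_iUnion.1 hθ
    exact hΘ q a θ ha s

section SampleIteration

variable {S A O Q E : Type*} [Fintype S] [Fintype O] {M : POMDP S A O} {φ : ILTL S}
  {D : LDBA Q (Set φ.atoms) E} {ρ : S → ℝ} {g C : ℝ} {F : Set Q}

/-- The average of vectors with entries in `[-C, C]` has entries in `[-C, C]`, so a backup is
bounded by `|ρ s| + g * C`. -/
theorem IsSampleBackup.bounded {Θ : AlphaSets S A Q E} (hC : 1 ≤ C) (hg : 0 ≤ g)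
    (hρ : ∀ s, |ρ s| + g * C ≤ C) (hΘ : ∀ q a, ∀ θ ∈ Θ q a, ∀ s, |θ s| ≤ C) {q : Q} {a : A ⊕ E}
    {ϑ : S → ℝ} (h : IsSampleBackup M φ D ρ g F Θ q a ϑ) (s : S) : |ϑ s| ≤ C := by
  obtain ⟨b, q', n, b', θ, hn, -, hθ, rfl⟩ := h
  have hn' : (0 : ℝ) < n := Nat.cast_pos.2 hn
  have hsum : |∑ i, θ i s| ≤ n * C :=
    (Finset.abs_sum_le_sum_abs _ _).trans <|
      (Finset.sum_le_sum fun i _ => stateVectors_bounded hC hΘ q' (θ i) (hθ i).1 s).trans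
        (by simp)
  calc |(ρ + (g / n) • ∑ i, θ i) s| = |ρ s + g / n * ∑ i, θ i s| := by simp
    _ ≤ |ρ s| + |g / n * ∑ i, θ i s| := abs_add_le _ _
    _ = |ρ s| + g / n * |∑ i, θ i s| := by rw [abs_mul, abs_of_nonneg (div_nonneg hg hn'.le)]
    _ ≤ |ρ s| + g / n * (n * C) := by gcongr
    _ = |ρ s| + g * C := by field_simp
    _ ≤ C := hρ s

theorem IsUpdate.bounded {Θ : ℕ → AlphaSets S A Q E} (hC : 1 ≤ C) (hg : 0 ≤ g)
    (hρ : ∀ s, |ρ s| + g * C ≤ C) (h₀ : ∀ q a, ∀ θ ∈ Θ 0 q a, ∀ s, |θ s| ≤ C)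
    (hΘ : ∀ k, IsUpdate M φ D ρ g F (Θ k) (Θ (k + 1))) (k : ℕ) :
    ∀ q a, ∀ θ ∈ Θ k q a, ∀ s, |θ s| ≤ C := by
  induction k with
  | zero => exact h₀
  | succ k ih =>
    intro q a θ hθ
    obtain ⟨N, -, hN, hsub, -⟩ := hΘ k q a
    rcases hsub hθ with h | h
    · exact ih q a θ h
    · exact (hN θ h).bounded hC hg hρ ih

theorem IsUpdate.exists_ge {Θ Θ' : AlphaSets S A Q E} (h : IsUpdate M φ D ρ g F Θ Θ') (q : Q)
    (a : A ⊕ E) (b : Belief S) {θ : S → ℝ} (hθ : θ ∈ Θ q a) :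
    ∃ θ' ∈ Θ' q a, ∑ s, θ s * b.1 s ≤ ∑ s, θ' s * b.1 s := by
  obtain ⟨N, -, -, -, hdom⟩ := h q a
  exact hdom b θ (Or.inl hθ)

theorem IsUpdate.exists_ge_stateVectors {Θ Θ' : AlphaSets S A Q E}
    (h : IsUpdate M φ D ρ g F Θ Θ') (q : Q) (b : Belief S) {θ : S → ℝ}
    (hθ : θ ∈ stateVectors F Θ q) :
    ∃ θ' ∈ stateVectors F Θ' q, ∑ s, θ s * b.1 s ≤ ∑ s, θ' s * b.1 s := by
  unfold stateVectors at hθ ⊢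
  split_ifs at hθ ⊢ with hq
  · exact ⟨θ, hθ, le_rfl⟩
  · obtain ⟨a, ha⟩ := Set.mem_iUnion.1 hθ
    obtain ⟨θ', hθ', hle⟩ := h.exists_ge q a b ha
    exact ⟨θ', Set.mem_iUnion.2 ⟨a, hθ'⟩, hle⟩

theorem IsUpdate.qvConverge [Finite A] [Nonempty A] [Finite Q] [Finite E]
    {Θ : ℕ → AlphaSets S A Q E} {C : NNReal} (hC : 1 ≤ (C : ℝ)) (hg : 0 ≤ g)
    (hρ : ∀ s, |ρ s| + g * C ≤ C) (h₀ : ∀ q a, ∀ θ ∈ Θ 0 q a, ∀ s, |θ s| ≤ C)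
    (hne : ∀ q (a : A), (Θ 0 q (Sum.inl a)).Nonempty)
    (hΘ : ∀ k, IsUpdate M φ D ρ g F (Θ k) (Θ (k + 1))) : QVConverge F Θ := by
  have hbdd := IsUpdate.bounded hC hg hρ h₀ hΘ
  constructor
  -- Nonemptiness is a premise inside the existential, so that `choose` yields a limit for every
  -- pair, with a dummy value at the pairs that stay empty.
  · have hlim : ∀ q a, ∃ l : Belief S → ℝ, (∃ k, (Θ k q a).Nonempty) →
        TendstoUniformly (fun k => maxValue (Θ k q a)) l Filter.atTop := fun q a => by
      by_cases hqa : ∃ k, (Θ k q a).Nonempty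
      · obtain ⟨l, hl⟩ := exists_tendstoUniformly_maxValue_of_nonempty
          (fun k => hbdd k q a) (fun k b θ hθ => (hΘ k).exists_ge q a b hθ) hqa
        exact ⟨l, fun _ => hl⟩
      · exact ⟨fun _ => 0, fun h => absurd h hqa⟩
    choose l hl using hlim
    refine ⟨fun y => l y.1.2 y.2 y.1.1, fun u hu => ?_⟩
    have hev : ∀ᶠ k in Filter.atTop, ∀ q a, (∃ k, (Θ k q a).Nonempty) →
        ∀ b, (l q a b, maxValue (Θ k q a) b) ∈ u :=
      Filter.eventually_all.2 fun q => Filter.eventually_all.2 fun a => by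
        by_cases hqa : ∃ k, (Θ k q a).Nonempty
        · exact (hl q a hqa u hu).mono fun k hk _ => hk
        · exact Filter.Eventually.of_forall fun _ h => absurd h hqa
    exact hev.mono fun k hk y hy => hk y.1.2 y.2 hy y.1.1
  · have hlim : ∀ q, ∃ l : Belief S → ℝ,
        TendstoUniformly (fun k => maxValue (stateVectors F (Θ k) q)) l Filter.atTop := fun q => by
      refine exists_tendstoUniformly_maxValue
        (fun k => stateVectors_bounded hC (hbdd k) q)
        (fun k b θ hθ => (hΘ k).exists_ge_stateVectors q b hθ) ?_
      unfold stateVectors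
      split_ifs
      · exact Set.singleton_nonempty _
      · obtain ⟨θ, hθ⟩ := hne q (Classical.arbitrary A)
        exact ⟨θ, Set.mem_iUnion.2 ⟨_, hθ⟩⟩
    choose l hl using hlim
    refine ⟨fun x => l x.2 x.1, fun u hu => ?_⟩
    exact (Filter.eventually_all.2 fun q => hl q u hu).mono fun k hk x => hk x.2 x.1

theorem IsInitial.exists_bound [Finite A] [Finite Q] [Finite E] {Θ : AlphaSets S A Q E}
    (h : IsInitial Θ) : ∃ c : ℝ, ∀ q a, ∀ θ ∈ Θ q a, ∀ s, |θ s| ≤ c := by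
  have hfin : (⋃ q, ⋃ a, Θ q a).Finite :=
    Set.finite_iUnion fun q => Set.finite_iUnion fun a => h.1 q a
  obtain ⟨c, hc⟩ := hfin.isBounded.exists_norm_le
  exact ⟨c, fun q a θ hθ s => (norm_le_pi_norm θ s).trans
    (hc θ (Set.mem_iUnion.2 ⟨q, Set.mem_iUnion.2 ⟨a, hθ⟩⟩))⟩

end SampleIteration

theorem theorem2 {S A O Q E : Type*} [Fintype S] [Fintype A] [Nonempty A] [Fintype O]
    [Fintype Q] [Fintype E] (M : POMDP S A O) (φ : ILTL S) (D : LDBA Q (Set φ.atoms) E) :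
    (∀ Θ : ℕ → AlphaSets S A Q E, IsInitial (Θ 0) →
      (∀ k, IsRewardUpdate M φ D (Θ k) (Θ (k + 1))) → QVConverge ∅ Θ) ∧
    (∀ Θ : ℕ → AlphaSets S A Q E, IsInitial (Θ 0) →
      (∀ k, IsBuchiUpdate M φ D (Θ k) (Θ (k + 1))) → QVConverge D.B Θ) := by
  refine ⟨fun Θ hinit hΘ => ?_, fun Θ hinit hΘ => ?_⟩
  · obtain ⟨c, hc⟩ := hinit.exists_bound
    obtain ⟨hγ₀, hγ₁⟩ := M.γ_mem
    have hγ : 0 < 1 - M.γ := sub_pos.2 hγ₁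
    -- The three terms cover the prescribed all-ones vector, the initial vectors, and the fixed
    -- point of `x ↦ ‖r‖ + γ x`, above which this map does not increase `x`.
    let C : NNReal := ⟨max 1 (max c (‖M.r‖ / (1 - M.γ))), zero_le_one.trans (le_max_left _ _)⟩
    have hcC : c ≤ C := (le_max_left _ _).trans (le_max_right _ _)
    have hrC : ‖M.r‖ / (1 - M.γ) ≤ C := (le_max_right _ _).trans (le_max_right _ _)
    refine IsUpdate.qvConverge (C := C) (le_max_left _ _) hγ₀.le (fun s => ?_)
      (fun q a θ hθ s => (hc q a θ hθ s).trans hcC) hinit.2 hΘ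
    have h₁ : |M.r s| ≤ ‖M.r‖ := norm_le_pi_norm M.r s
    have h₂ := (div_le_iff₀ hγ).1 hrC
    linarith
  · obtain ⟨c, hc⟩ := hinit.exists_bound
    -- With `ρ = 0` and `g = 1` a backup is a plain average, so any bound is preserved.
    let C : NNReal := ⟨max 1 c, zero_le_one.trans (le_max_left _ _)⟩
    have hcC : c ≤ C := le_max_right _ _
    exact IsUpdate.qvConverge (C := C) (le_max_left _ _) zero_le_one (fun s => by simp)
      (fun q a θ hθ s => (hc q a θ hθ s).trans hcC) hinit.2 hΘ
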